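/- Consider episodic MDPs with $H\ge 1$ stages, $k\ge 1$ levels (states) in each stage and $A\ge 1$ actions. An episode starts at the first level of stage $1$; playing action $a$ at level $l$ of stage $i$ yields a random reward $R_{l,i}(a)$ with mean $r_{l,i}(a)$ and leads to level $s$ of stage $i+1$ with probability $p_i(s\mid l,a)$ (the reward and the next level may be correlated). All rewards are non-negative and the total reward of an episode is at most $1$, almost surely under every policy. A (deterministic) policy $\pi$ prescribes an action for each pair $(l,i)$; its value $V(\pi)$ is the expected total reward of an episode played with $\pi$, and $\mathsf{Opt}=\max_\pi V(\pi)$. The transition probabilities and the reward distributions are unknown to the learner, while $H$, $k$, $A$ and the number of episodes $T$ are known. In each episode $t=1,\dots,T$ the learner chooses, possibly at random, a policy $\pi^t$ on the basis of the policies it played and the total rewards it observed in the earlier episodes, and then observes only the total reward of one execution of $\pi^t$ (fully bandit feedback: neither the visited states nor the individual rewards are seen). There is a universal constant $C>0$ such that for all integers $H,k,A\ge 1$ and $T\ge 2$ there is an online learning algorithm of this kind which, for every such MDP, has expected regret $$\mathbb{E}\Big[\sum_{t=1}^{T}\big(\mathsf{Opt}-V(\pi^t)\big)\Big]\;\le\;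 C\,H^2(Ak)^H\sqrt{HkAT\log T}.$$ -/

import Mathlib

open MeasureTheory ProbabilityTheory

/-- A deterministic policy: the action `π i l` is played at level `l` of stage `i`.
Stages and levels are numbered from `0`. -/
abbrev Policy (H k A : ℕ) : Type := Fin H → Fin k → Fin A

/-- An episodic MDP with `H` stages, `k` levels per stage and `A` actions. Playing action `a` at
level `l` of stage `i` produces a random pair (reward, level at the next stage) with law
`step i l a`. So the transition probability `p_i(s | l, a)` is the mass that the second marginal
gives to `s`, and the mean reward `r_{l,i}(a)` is the mean of the first marginal; the reward and
the next level may be correlated. The level produced by the last stage is irrelevant. -/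
structure EpisodicMDP (H k A : ℕ) where
  step : Fin H → Fin k → Fin A → Measure (ℝ × Fin k)
  isProbabilityMeasure_step : ∀ i l a, IsProbabilityMeasure (step i l a)

namespace EpisodicMDP

variable {H k A : ℕ}

/-- For a level `l`, the law of the total reward collected in the stages `i, i + 1, …, H - 1` when
the policy `π` is followed from level `l` of stage `i`: draw a reward and the next level, then add
the total reward collected from the next level on. -/
noncomputable def tailReward (M : EpisodicMDP H k A) (π : Policy H k A) (i : ℕ) :
    Kernel (Fin k) ℝ :=
  if h : i < H then
    Kernel.ofFunOfCountable fun l =>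
      (M.step ⟨i, h⟩ l (π ⟨i, h⟩ l) ⊗ₘ (M.tailReward π (i + 1)).prodMkLeft ℝ).map
        fun z => z.1.1 + z.2
  else Kernel.const (Fin k) (Measure.dirac 0)
termination_by H - i

theorem isMarkovKernel_tailReward (M : EpisodicMDP H k A) (π : Policy H k A) (i : ℕ) :
    IsMarkovKernel (M.tailReward π i) := by
  rw [tailReward]
  split_ifs with h
  · have ih := M.isMarkovKernel_tailReward π (i + 1)
    refine ⟨fun l => ?_⟩
    have := M.isProbabilityMeasure_step ⟨i, h⟩ l (π ⟨i, h⟩ l)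
    change IsProbabilityMeasure (Measure.map _ _)
    exact Measure.isProbabilityMeasure_map (by fun_prop)
  · infer_instance
termination_by H - i

variable [NeZero k]

/-- The law of the total reward of one episode played with policy `π`, as a kernel in `π`.
Episodes start at the first level of the first stage. -/
noncomputable def episodeReward (M : EpisodicMDP H k A) : Kernel (Policy H k A) ℝ :=
  Kernel.ofFunOfCountable fun π => M.tailReward π 0 0

instance (M : EpisodicMDP H k A) : IsMarkovKernel M.episodeReward :=
  ⟨fun π => (M.isMarkovKernel_tailReward π 0).isProbabilityMeasure 0⟩

/-- All rewards are non-negative, and the total reward of an episode is at most one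
(almost surely, whatever policy is played). -/
def BoundedRewards (M : EpisodicMDP H k A) : Prop :=
  (∀ i l a, ∀ᵐ z ∂M.step i l a, 0 ≤ z.1) ∧ ∀ π, ∀ᵐ x ∂M.episodeReward π, x ≤ 1

/-- The value `V(π)`: the expected total reward of an episode played with policy `π`. -/
noncomputable def value (M : EpisodicMDP H k A) (π : Policy H k A) : ℝ :=
  ∫ x, x ∂M.episodeReward π

/-- The value of an optimal policy. -/
noncomputable def opt (M : EpisodicMDP H k A) : ℝ := ⨆ π, M.value π

end EpisodicMDP

/-- What the learner has seen after `t` episodes under bandit feedback: for each of them, the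
policy that was played and the total reward that was observed, and nothing else. -/
abbrev History (H k A t : ℕ) : Type := Fin t → Policy H k A × ℝ

/-- An online learning algorithm with bandit feedback: before episode `t` it draws the policy to be
played from a distribution that depends (measurably) on the history only. -/
structure BanditAlgorithm (H k A : ℕ) where
  choose : (t : ℕ) → Kernel (History H k A t) (Policy H k A)
  isMarkovKernel_choose : ∀ t, IsMarkovKernel (choose t)

namespace BanditAlgorithm

variable {H k A : ℕ}

theorem measurable_snoc_history (t : ℕ) :
    Measurable fun z : (History H k A t × Policy H k A) × ℝ =>
      (Fin.snoc (α := fun _ => Policy H k A × ℝ) z.1.1 (z.1.2, z.2) : History H k A (t + 1)) := by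
  refine measurable_pi_iff.2 fun j => ?_
  refine Fin.lastCases ?_ (fun j => ?_) j
  · simp only [Fin.snoc_last]; fun_prop
  · simp only [Fin.snoc_castSucc]; fun_prop

variable [NeZero k]

/-- The law of the history of the first `t` episodes when the algorithm interacts with `M`. In each
episode the algorithm draws a policy given the history, and then the total reward is drawn from
the reward law of that policy, independently of the past given the policy. -/
noncomputable def historyLaw (alg : BanditAlgorithm H k A) (M : EpisodicMDP H k A) :
    (t : ℕ) → Measure (History H k A t)
  | 0 => Measure.dirac Fin.elim0
  | t + 1 =>
    ((alg.historyLaw M t ⊗ₘ alg.choose t) ⊗ₘ M.episodeReward.prodMkLeft (History H k A t)).map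
      fun z => Fin.snoc (α := fun _ => Policy H k A × ℝ) z.1.1 (z.1.2, z.2)

instance (alg : BanditAlgorithm H k A) (M : EpisodicMDP H k A) (t : ℕ) :
    IsProbabilityMeasure (alg.historyLaw M t) := by
  induction t with
  | zero => rw [historyLaw]; infer_instance
  | succ t ih =>
    have := alg.isMarkovKernel_choose t
    rw [historyLaw]
    exact Measure.isProbabilityMeasure_map (measurable_snoc_history t).aemeasurable

/-- The expected cumulative regret over `T` episodes, `𝔼 [∑ t, (Opt - V(π^t))]`, where the
expectation is over the draws of the algorithm and of the MDP. -/
noncomputable def expectedRegret (alg : BanditAlgorithm H k A) (M : EpisodicMDP H k A) (T : ℕ) :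
    ℝ :=
  ∫ h, ∑ t : Fin T, (M.opt - M.value (h t).1) ∂alg.historyLaw M T

end BanditAlgorithm

/-! Bandit feedback hides everything except the pair (policy, total reward), so the problem is a
bandit whose arms are the policies; what makes it tractable is that the values are linear. The
Bellman recursion writes V(π) as a weighted sum, over sequences of one (level, action) pair per
stage, of the indicator that π plays these actions. There are (Ak)^H such sequences, so V lies in a
space W of dimension n ≤ (Ak)^H that does not depend on the MDP
(`BoundedRewards.value_mem_trajectorySpan`).

A barycentric spanner of W represents each policy by a vector c π in [-1, 1]^n with V(π) = c π ⬝ θ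
for an unknown θ. The learner runs exponential weights on least squares estimates of all values,
mixed at rate γ with uniform exploration of the spanner. The estimates are unbiased, exploration
bounds them by n²/γ, and their variance averaged over the sampling law is at most n
(`sum_gainKernel_mul`, `abs_gainKernel_le`, `sum_gainKernel_self`). Hence the regret so far plus the
potential grows in expectation by at most 2ηn + γ per episode (`sum_mixedWeights_mul_integral_le`).

Since the log of the number of policies is at most L = HkA, the choice η = s/n, γ = ns with s =
√(L/T) gives regret at most 4n√(LT). The factors H² and √log T in the theorem are slack. -/

/-! ### Barycentric spanners. -/

/-- A finite-dimensional space of functions on a finite type has a barycentric spanner: a family of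
points such that evaluation at any point is a combination with coefficients in `[-1, 1]` of the
evaluations at the family. -/
theorem exists_barycentric_spanner {ι : Type*} [Finite ι] (W : Submodule ℝ (ι → ℝ)) :
    ∃ (b : Fin (Module.finrank ℝ W) → ι) (c : ι → Fin (Module.finrank ℝ W) → ℝ),
      (∀ f ∈ W, ∀ i, f i = ∑ j, c i j * f (b j)) ∧ (∀ i j, |c i j| ≤ 1) ∧
        ∀ j, c (b j) = Pi.single j 1 := by
  classical
  set n := Module.finrank ℝ W
  let E : ι → Module.Dual ℝ W := fun i => (LinearMap.proj i).comp W.subtype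
  -- A function on which every evaluation vanishes is zero, so the evaluations span the dual.
  have hspan : Submodule.span ℝ (Set.range E) = ⊤ := by
    rw [← Subspace.dualCoannihilator_dualAnnihilator_eq (W := Submodule.span ℝ (Set.range E)),
      ← Submodule.dualAnnihilator_bot]
    congr 1
    rw [eq_bot_iff]
    intro f hf
    rw [Submodule.mem_dualCoannihilator] at hf
    rw [Submodule.mem_bot]
    ext i
    exact hf (E i) (Submodule.subset_span ⟨i, rfl⟩)
  obtain ⟨s, hs, hsp, hli⟩ := exists_linearIndependent ℝ (Set.range E)
  let e₀ : Module.Basis s ℝ (Module.Dual ℝ W) :=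
    Module.Basis.mk hli (by rw [Subtype.range_coe, hsp, hspan])
  have hsfin : Finite s := Set.Finite.subset (Set.finite_range E) hs
  have := Fintype.ofFinite s
  have hcard : Fintype.card s = n := by
    rw [← Module.finrank_eq_card_basis e₀]; exact Subspace.dual_finrank_eq
  let e := e₀.reindex (Fintype.equivFinOfCardEq hcard)
  have hne : Nonempty (Fin n → ι) :=
    ⟨fun j => (hs ((Fintype.equivFinOfCardEq hcard).symm j).2).choose⟩
  -- The spanner is a family of maximal volume.
  obtain ⟨b, hb⟩ := Finite.exists_max fun v : Fin n → ι => |e.det (E ∘ v)|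
  have hdet : e.det (E ∘ b) ≠ 0 := by
    let v : Fin n → ι := fun j => (hs ((Fintype.equivFinOfCardEq hcard).symm j).2).choose
    have hv : E ∘ v = e := by
      funext j
      have := (hs ((Fintype.equivFinOfCardEq hcard).symm j).2).choose_spec
      simpa [e, e₀] using this
    have h1 := hb v
    rw [hv, e.det_self] at h1
    intro h0
    rw [h0] at h1
    norm_num at h1
  have hbasis := (Module.Basis.is_basis_iff_det e).2 (isUnit_iff_ne_zero.2 hdet)
  let B := Module.Basis.mk hbasis.1 hbasis.2.ge
  have hB : ∀ j, B j = E (b j) := fun j => by simp [B]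
  refine ⟨b, fun i j => B.coord j (E i), fun f hf i => ?_, fun i j => ?_, fun j => ?_⟩
  · have := congrArg (fun L : Module.Dual ℝ W => L ⟨f, hf⟩) (B.sum_repr (E i))
    simp only [LinearMap.sum_apply, LinearMap.smul_apply, hB] at this
    simpa [E] using this.symm
  -- Cramer's rule: the j-th coordinate of `E i` is the ratio of the determinants after and before
  -- replacing `b j` by `i`, at most 1 in absolute value by maximality.
  · have h := congrArg (fun L => L (E i))
      (e.det_smul_mk_coord_eq_det_update hbasis.1 hbasis.2.ge j)
    simp only [LinearMap.smul_apply, smul_eq_mul, MultilinearMap.toLinearMap_apply] at h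
    have h2 : Function.update (E ∘ b) j (E i) = E ∘ Function.update b j i := by
      rw [Function.comp_update]
    have h3 := hb (Function.update b j i)
    rw [← h2] at h3
    have h4 : |e.det (E ∘ b)| * |B.coord j (E i)| ≤ |e.det (E ∘ b)| * 1 := by
      rw [← abs_mul, mul_one]
      exact (congrArg abs h).le.trans h3
    exact le_of_mul_le_mul_left h4 (abs_pos.2 hdet)
  · funext i
    change B.coord i (E (b j)) = _
    rw [← hB]
    simp [Finsupp.single_apply, Pi.single_apply, eq_comm]

/-! ### Linearity of the value in the trajectory indicators. -/

namespace EpisodicMDP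

variable {H k A : ℕ}

/-- The indicator that the policy `π` plays the actions of the trajectory `τ` from stage `i` on. -/
def trajectoryIndicator (R : Type*) [CommSemiring R] (i : ℕ) (τ : Fin H → Fin k × Fin A)
    (π : Policy H k A) : R :=
  ∏ j : Fin H, if i ≤ j ∧ π j (τ j).1 ≠ (τ j).2 then 0 else 1

/-- The indicator from stage `i + 1` on ignores the entry of `τ` at stage `i`, so that entry is free
to record `(l, a)`. -/
theorem ite_mul_trajectoryIndicator_succ (R : Type*) [CommSemiring R] {i : ℕ} (h : i < H)
    (l : Fin k) (a : Fin A) (τ : Fin H → Fin k × Fin A) (π : Policy H k A) :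
    (if π ⟨i, h⟩ l = a then 1 else 0) * trajectoryIndicator R (i + 1) τ π =
      trajectoryIndicator R i (Function.update τ ⟨i, h⟩ (l, a)) π := by
  unfold trajectoryIndicator
  rw [Fintype.prod_eq_mul_prod_compl (⟨i, h⟩ : Fin H), Fintype.prod_eq_mul_prod_compl ⟨i, h⟩]
  simp only [add_le_iff_nonpos_right, nonpos_iff_eq_zero, one_ne_zero, false_and, if_false,
    one_mul, le_refl, true_and, Function.update_self]
  congr 1
  · by_cases hπ : π ⟨i, h⟩ l = a <;> simp [hπ]
  · refine Finset.prod_congr rfl fun j hj => ?_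
    have hne : j ≠ ⟨i, h⟩ := by simpa using hj
    have hne' : i ≠ j := fun h => hne (Fin.ext h.symm)
    rw [Function.update_of_ne hne]
    simp only [Nat.succ_le_iff, lt_iff_le_and_ne, hne', ne_eq, not_false_eq_true, and_true]

/-- The functions on policies spanned by the trajectory indicators from stage `i` on. -/
abbrev trajectorySpan (R : Type*) [CommSemiring R] (H k A i : ℕ) :
    Submodule R (Policy H k A → R) :=
  Submodule.span R (Set.range (trajectoryIndicator R i))

theorem ite_mul_mem_trajectorySpan {R : Type*} [CommSemiring R] {i : ℕ} (h : i < H)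
    (l : Fin k) (a : Fin A) {f : Policy H k A → R} (hf : f ∈ trajectorySpan R H k A (i + 1)) :
    (fun π => (if π ⟨i, h⟩ l = a then 1 else 0) * f π) ∈ trajectorySpan R H k A i := by
  have : trajectorySpan R H k A (i + 1) ≤ (trajectorySpan R H k A i).comap
      (LinearMap.mulLeft R fun π : Policy H k A => if π ⟨i, h⟩ l = a then (1 : R) else 0) := by
    refine Submodule.span_le.2 ?_
    rintro _ ⟨τ, rfl⟩
    refine Submodule.subset_span ⟨Function.update τ ⟨i, h⟩ (l, a), ?_⟩
    funext π
    exact (ite_mul_trajectoryIndicator_succ R h l a τ π).symm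
  exact this hf

/-- Split according to the action that `π` plays at level `l`: exactly one indicator is nonzero. -/
theorem comp_action_mem_trajectorySpan {R : Type*} [CommSemiring R] {i : ℕ} (h : i < H)
    (l : Fin k) {f : Fin A → Policy H k A → R} (hf : ∀ a, f a ∈ trajectorySpan R H k A (i + 1)) :
    (fun π => f (π ⟨i, h⟩ l) π) ∈ trajectorySpan R H k A i := by
  have : (fun π => f (π ⟨i, h⟩ l) π) =
      ∑ a, fun π : Policy H k A => (if π ⟨i, h⟩ l = a then 1 else 0) * f a π := by
    funext π
    simp
  rw [this]
  exact Submodule.sum_mem _ fun a _ => ite_mul_mem_trajectorySpan h l a (hf a)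

theorem one_mem_trajectorySpan [NeZero k] [NeZero A] (R : Type*) [CommSemiring R] (i : ℕ) :
    1 ∈ trajectorySpan R H k A i := by
  by_cases h : i < H
  · exact comp_action_mem_trajectorySpan h 0 (f := fun _ => 1)
      fun _ => one_mem_trajectorySpan R (i + 1)
  · refine Submodule.subset_span ⟨fun _ => (0, 0), ?_⟩
    funext π
    refine Finset.prod_eq_one fun j _ => if_neg fun hj => ?_
    omega
termination_by H - i

theorem ae_nonneg_tailReward (M : EpisodicMDP H k A)
    (hM : ∀ i l a, ∀ᵐ z ∂M.step i l a, 0 ≤ z.1) (π : Policy H k A) (i : ℕ) (l : Fin k) :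
    ∀ᵐ x ∂M.tailReward π i l, 0 ≤ x := by
  rw [tailReward]
  split_ifs with h
  · have := M.isProbabilityMeasure_step ⟨i, h⟩ l (π ⟨i, h⟩ l)
    have := M.isMarkovKernel_tailReward π (i + 1)
    change ∀ᵐ x ∂Measure.map _ _, 0 ≤ x
    rw [ae_map_iff (by fun_prop) measurableSet_Ici]
    refine (Measure.ae_compProd_iff (measurableSet_le (by fun_prop) (by fun_prop))).2 ?_
    filter_upwards [hM ⟨i, h⟩ l (π ⟨i, h⟩ l)] with z hz
    filter_upwards [M.ae_nonneg_tailReward hM π (i + 1) z.2] with y hy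
    exact add_nonneg hz hy
  · simp
termination_by H - i

/-- The Bellman recursion for the expected total reward, with values in `[0, ∞]`. -/
theorem lintegral_tailReward (M : EpisodicMDP H k A)
    (hM : ∀ i l a, ∀ᵐ z ∂M.step i l a, 0 ≤ z.1) (π : Policy H k A) {i : ℕ} (h : i < H)
    (l : Fin k) :
    ∫⁻ x, ENNReal.ofReal x ∂M.tailReward π i l =
      ∫⁻ z, ENNReal.ofReal z.1 ∂M.step ⟨i, h⟩ l (π ⟨i, h⟩ l) +
        ∑ s, (M.step ⟨i, h⟩ l (π ⟨i, h⟩ l)).map Prod.snd {s} *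
          ∫⁻ x, ENNReal.ofReal x ∂M.tailReward π (i + 1) s := by
  have := M.isProbabilityMeasure_step ⟨i, h⟩ l (π ⟨i, h⟩ l)
  have := M.isMarkovKernel_tailReward π (i + 1)
  rw [tailReward, dif_pos h]
  change ∫⁻ x, ENNReal.ofReal x ∂Measure.map _ _ = _
  rw [lintegral_map (by fun_prop) (by fun_prop), Measure.lintegral_compProd (by fun_prop)]
  have hstep : ∀ᵐ z ∂M.step ⟨i, h⟩ l (π ⟨i, h⟩ l),
      ∫⁻ y, ENNReal.ofReal (z.1 + y) ∂(M.tailReward π (i + 1)).prodMkLeft ℝ z =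
        ENNReal.ofReal z.1 + ∫⁻ y, ENNReal.ofReal y ∂M.tailReward π (i + 1) z.2 := by
    filter_upwards [hM ⟨i, h⟩ l (π ⟨i, h⟩ l)] with z hz
    rw [Kernel.prodMkLeft_apply]
    have : ∀ᵐ y ∂M.tailReward π (i + 1) z.2,
        ENNReal.ofReal (z.1 + y) = ENNReal.ofReal z.1 + ENNReal.ofReal y := by
      filter_upwards [M.ae_nonneg_tailReward hM π (i + 1) z.2] with y hy
      exact ENNReal.ofReal_add hz hy
    rw [lintegral_congr_ae this, lintegral_add_left (by fun_prop), lintegral_const,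
      measure_univ, mul_one]
  rw [lintegral_congr_ae hstep, lintegral_add_left (by fun_prop)]
  congr 1
  rw [← lintegral_map (f := fun s => ∫⁻ y, ENNReal.ofReal y ∂M.tailReward π (i + 1) s)
    (by fun_prop) measurable_snd, lintegral_fintype]
  simp_rw [mul_comm]

/-- Backward induction along the Bellman recursion. Values are taken in `[0, ∞]` because the bound
on the total reward says nothing about levels that no policy reaches, where the tail reward may have
infinite mean. -/
theorem lintegral_tailReward_mem_trajectorySpan [NeZero k] [NeZero A] (M : EpisodicMDP H k A)
    (hM : ∀ i l a, ∀ᵐ z ∂M.step i l a, 0 ≤ z.1) (i : ℕ) (l : Fin k) :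
    (fun π => ∫⁻ x, ENNReal.ofReal x ∂M.tailReward π i l) ∈ trajectorySpan ENNReal H k A i := by
  by_cases h : i < H
  · simp_rw [M.lintegral_tailReward hM _ h l]
    refine comp_action_mem_trajectorySpan h l
      (f := fun a π => ∫⁻ z, ENNReal.ofReal z.1 ∂M.step ⟨i, h⟩ l a +
        ∑ s, (M.step ⟨i, h⟩ l a).map Prod.snd {s} *
          ∫⁻ x, ENNReal.ofReal x ∂M.tailReward π (i + 1) s) fun a => ?_
    have hsum := Submodule.add_mem _
      (Submodule.smul_mem _ (∫⁻ z, ENNReal.ofReal z.1 ∂M.step ⟨i, h⟩ l a)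
        (one_mem_trajectorySpan (H := H) (k := k) (A := A) ENNReal (i + 1)))
      (Submodule.sum_mem (trajectorySpan ENNReal H k A (i + 1)) fun s (_ : s ∈ Finset.univ) =>
        Submodule.smul_mem _ ((M.step ⟨i, h⟩ l a).map Prod.snd {s})
          (M.lintegral_tailReward_mem_trajectorySpan hM (i + 1) s))
    convert hsum using 1
    funext π
    simp
  · have : (fun π => ∫⁻ x, ENNReal.ofReal x ∂M.tailReward π i l) = 0 := by
      funext π
      rw [tailReward, dif_neg h]
      simp
    rw [this]
    exact Submodule.zero_mem _
termination_by H - i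

variable [NeZero k]

theorem BoundedRewards.ae_mem_Icc {M : EpisodicMDP H k A} (hM : M.BoundedRewards)
    (π : Policy H k A) : ∀ᵐ x ∂M.episodeReward π, x ∈ Set.Icc (0 : ℝ) 1 := by
  filter_upwards [M.ae_nonneg_tailReward hM.1 π 0 0, hM.2 π] with x h0 h1
  exact ⟨h0, h1⟩

theorem BoundedRewards.integrable {M : EpisodicMDP H k A} (hM : M.BoundedRewards)
    (π : Policy H k A) : Integrable (fun x => x) (M.episodeReward π) := by
  refine Integrable.of_bound (by fun_prop) 1 ?_
  filter_upwards [hM.ae_mem_Icc π] with x hx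
  rw [Real.norm_eq_abs, abs_of_nonneg hx.1]
  exact hx.2

theorem BoundedRewards.value_mem_Icc {M : EpisodicMDP H k A} (hM : M.BoundedRewards)
    (π : Policy H k A) : M.value π ∈ Set.Icc (0 : ℝ) 1 := by
  refine ⟨integral_nonneg_of_ae ((hM.ae_mem_Icc π).mono fun x hx => hx.1), ?_⟩
  have := integral_mono_ae (hM.integrable π) (integrable_const 1)
    ((hM.ae_mem_Icc π).mono fun x hx => hx.2)
  simpa [value] using this

theorem BoundedRewards.value_mem_trajectorySpan [NeZero A] {M : EpisodicMDP H k A}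
    (hM : M.BoundedRewards) : M.value ∈ trajectorySpan ℝ H k A 0 := by
  obtain ⟨w, hw⟩ := (Submodule.mem_span_range_iff_exists_fun ENNReal).1
    (M.lintegral_tailReward_mem_trajectorySpan hM.1 0 0)
  refine (Submodule.mem_span_range_iff_exists_fun ℝ).2 ⟨fun τ => (w τ).toReal, ?_⟩
  funext π
  have hval : ∫⁻ x, ENNReal.ofReal x ∂M.tailReward π 0 0 = ENNReal.ofReal (M.value π) :=
    (ofReal_integral_eq_lintegral_ofReal (hM.integrable π)
      ((hM.ae_mem_Icc π).mono fun x hx => hx.1)).symm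
  have hπ : ∑ τ, w τ * trajectoryIndicator ENNReal 0 τ π = ENNReal.ofReal (M.value π) := by
    rw [← hval, ← congrFun hw π]
    simp
  -- The terms sum to a finite value, so each is finite and the identity descends to the reals.
  have hfin : ∀ τ ∈ Finset.univ, w τ * trajectoryIndicator ENNReal 0 τ π ≠ ⊤ :=
    ENNReal.sum_ne_top.1 (hπ ▸ ENNReal.ofReal_ne_top)
  rw [← ENNReal.toReal_ofReal (hM.value_mem_Icc π).1, ← hπ, ENNReal.toReal_sum hfin]
  simp only [Finset.sum_apply, Pi.smul_apply, smul_eq_mul, ENNReal.toReal_mul]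
  refine Finset.sum_congr rfl fun τ _ => congrArg _ ?_
  simp only [trajectoryIndicator, ENNReal.toReal_prod]
  refine Finset.prod_congr rfl fun j _ => ?_
  split_ifs <;> simp

omit [NeZero k] in
theorem finrank_trajectorySpan_le (i : ℕ) :
    Module.finrank ℝ (trajectorySpan ℝ H k A i) ≤ (A * k) ^ H := by
  refine (finrank_range_le_card _).trans ?_
  simp [mul_comm]

end EpisodicMDP

/-! ### Least squares estimation under exploration of a spanner. -/

namespace LinearBandit

open Matrix

variable {ι : Type*} [Fintype ι] {n : ℕ}

/-- The second moment matrix of the features `c` under the weights `p`. -/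
def secondMoment (c : ι → Fin n → ℝ) (p : ι → ℝ) : Matrix (Fin n) (Fin n) ℝ :=
  ∑ i, p i • vecMulVec (c i) (c i)

/-- The coefficient of the reward of `j` in the least squares estimate of the value of `i`. -/
noncomputable def gainKernel (c : ι → Fin n → ℝ) (p : ι → ℝ) (i j : ι) : ℝ :=
  c i ⬝ᵥ ((secondMoment c p)⁻¹ *ᵥ c j)

theorem secondMoment_mulVec (c : ι → Fin n → ℝ) (p : ι → ℝ) (x : Fin n → ℝ) :
    secondMoment c p *ᵥ x = ∑ i, (p i * (c i ⬝ᵥ x)) • c i := by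
  rw [secondMoment, Matrix.sum_mulVec]
  refine Finset.sum_congr rfl fun i _ => ?_
  rw [Matrix.smul_mulVec, vecMulVec_mulVec, mul_smul]
  simp

theorem dotProduct_secondMoment_mulVec (c : ι → Fin n → ℝ) (p : ι → ℝ) (x y : Fin n → ℝ) :
    y ⬝ᵥ (secondMoment c p *ᵥ x) = ∑ i, p i * (c i ⬝ᵥ x) * (c i ⬝ᵥ y) := by
  rw [secondMoment_mulVec, dotProduct_sum]
  refine Finset.sum_congr rfl fun i _ => ?_
  rw [dotProduct_smul, smul_eq_mul, dotProduct_comm y]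

theorem isSymm_secondMoment (c : ι → Fin n → ℝ) (p : ι → ℝ) : (secondMoment c p).IsSymm := by
  simp [Matrix.IsSymm, secondMoment, Matrix.transpose_sum, transpose_vecMulVec]

/-- Weights that explore a spanner: `b` is a family of points whose features are the standard basis
and each of them has its share of the exploration rate `γ`. -/
structure Explores (c : ι → Fin n → ℝ) (b : Fin n → ι) (γ : ℝ) (p : ι → ℝ) : Prop where
  rate_pos : 0 < γ
  dim_pos : 0 < n
  basis : ∀ j, c (b j) = Pi.single j 1
  bounded : ∀ i j, |c i j| ≤ 1
  nonneg : ∀ i, 0 ≤ p i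
  share : ∀ j, γ / n ≤ p (b j)

namespace Explores

variable {c : ι → Fin n → ℝ} {b : Fin n → ι} {γ : ℝ} {p : ι → ℝ}

/-- The spanner points alone contribute this much: their features are the coordinate vectors and
each has weight at least γ/n. -/
theorem le_dotProduct_secondMoment (h : Explores c b γ p) (x : Fin n → ℝ) :
    γ / n * (x ⬝ᵥ x) ≤ x ⬝ᵥ (secondMoment c p *ᵥ x) := by
  classical
  have hinj : Function.Injective b := fun j j' hj => by
    have := congrFun ((h.basis j).symm.trans ((congrArg c hj).trans (h.basis j'))) j
    by_contra hne
    simp [hne] at this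
  rw [dotProduct_secondMoment_mulVec]
  calc γ / n * (x ⬝ᵥ x) = ∑ j, γ / n * (x j * x j) := by rw [dotProduct, Finset.mul_sum]
    _ ≤ ∑ j, p (b j) * (c (b j) ⬝ᵥ x) * (c (b j) ⬝ᵥ x) := by
      refine Finset.sum_le_sum fun j _ => ?_
      rw [h.basis, single_dotProduct, one_mul, mul_assoc]
      exact mul_le_mul_of_nonneg_right (h.share j) (mul_self_nonneg _)
    _ = ∑ i ∈ Finset.univ.image b, p i * (c i ⬝ᵥ x) * (c i ⬝ᵥ x) := by
      rw [Finset.sum_image fun _ _ _ _ hj => hinj hj]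
    _ ≤ _ := Finset.sum_le_sum_of_subset_of_nonneg (Finset.subset_univ _) fun i _ _ => by
      rw [mul_assoc]; exact mul_nonneg (h.nonneg i) (mul_self_nonneg _)

theorem isUnit_det (h : Explores c b γ p) : IsUnit (secondMoment c p).det := by
  have hn : (0 : ℝ) < n := Nat.cast_pos.2 h.dim_pos
  rw [isUnit_iff_ne_zero]
  intro h0
  obtain ⟨x, hx, hx0⟩ := exists_mulVec_eq_zero_iff.2 h0
  have := h.le_dotProduct_secondMoment x
  rw [hx0, dotProduct_zero] at this
  have hpos : 0 < x ⬝ᵥ x :=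
    lt_of_le_of_ne (Finset.sum_nonneg fun i _ => mul_self_nonneg _)
      fun h0 => hx (dotProduct_self_eq_zero.1 h0.symm)
  have := mul_pos (div_pos h.rate_pos hn) hpos
  linarith

/-- Unbiasedness of the estimates when the arm `j` is drawn from `p`. -/
theorem sum_gainKernel_mul (h : Explores c b γ p) (θ : Fin n → ℝ) (i : ι) :
    ∑ j, p j * (gainKernel c p i j * (c j ⬝ᵥ θ)) = c i ⬝ᵥ θ := by
  have h1 : (secondMoment c p)⁻¹ *ᵥ (secondMoment c p *ᵥ θ) = θ := by
    rw [mulVec_mulVec, nonsing_inv_mul _ h.isUnit_det, one_mulVec]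
  conv_rhs => rw [← h1, secondMoment_mulVec, mulVec_sum, dotProduct_sum]
  refine Finset.sum_congr rfl fun j _ => ?_
  rw [mulVec_smul, dotProduct_smul, gainKernel, smul_eq_mul]
  ring

theorem gainKernel_comm (c : ι → Fin n → ℝ) (p : ι → ℝ) (i j : ι) :
    gainKernel c p i j = gainKernel c p j i := by
  have : ((secondMoment c p)⁻¹)ᵀ = (secondMoment c p)⁻¹ := by
    rw [transpose_nonsing_inv, isSymm_secondMoment]
  rw [gainKernel, gainKernel, dotProduct_mulVec, ← mulVec_transpose, this, dotProduct_comm]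

/-- Second moment of the estimate for arm `i`: with Q the second moment matrix, Q⁻¹ Q Q⁻¹ = Q⁻¹. -/
theorem sum_gainKernel_sq (h : Explores c b γ p) (i : ι) :
    ∑ j, p j * gainKernel c p i j ^ 2 = gainKernel c p i i := by
  have h1 : secondMoment c p *ᵥ ((secondMoment c p)⁻¹ *ᵥ c i) = c i := by
    rw [mulVec_mulVec, mul_nonsing_inv _ h.isUnit_det, one_mulVec]
  have h2 := dotProduct_secondMoment_mulVec c p ((secondMoment c p)⁻¹ *ᵥ c i)
    ((secondMoment c p)⁻¹ *ᵥ c i)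
  rw [h1, dotProduct_comm] at h2
  rw [gainKernel, h2]
  refine Finset.sum_congr rfl fun j _ => ?_
  rw [gainKernel_comm, gainKernel]
  ring

/-- The sum is the trace of Q Q⁻¹, so the averaged variance depends on the dimension and not on the
number of arms. -/
theorem sum_gainKernel_self (h : Explores c b γ p) : ∑ i, p i * gainKernel c p i i = n := by
  have h1 : (secondMoment c p * (secondMoment c p)⁻¹).trace = n := by
    rw [mul_nonsing_inv _ h.isUnit_det, trace_one, Fintype.card_fin]
  rw [← h1]
  conv_rhs => rw [secondMoment, Finset.sum_mul, trace_sum]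
  refine Finset.sum_congr rfl fun i _ => ?_
  rw [smul_mul, trace_smul, vecMulVec_mul, trace_vecMulVec, gainKernel, smul_eq_mul,
    ← secondMoment, dotProduct_mulVec, dotProduct_comm]

omit [Fintype ι] in
theorem abs_dotProduct_le (h : Explores c b γ p) (i : ι) (u : Fin n → ℝ) :
    (c i ⬝ᵥ u) ^ 2 ≤ n * (u ⬝ᵥ u) := by
  have h1 : (c i ⬝ᵥ u) ^ 2 ≤ (c i ⬝ᵥ c i) * (u ⬝ᵥ u) := by
    have := Finset.sum_mul_sq_le_sq_mul_sq Finset.univ (c i) u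
    simpa only [dotProduct, pow_two] using this
  refine h1.trans (mul_le_mul_of_nonneg_right ?_ (Finset.sum_nonneg fun _ _ => mul_self_nonneg _))
  calc c i ⬝ᵥ c i ≤ ∑ _j : Fin n, (1 : ℝ) := Finset.sum_le_sum fun j _ => by
        have := (sq_le_one_iff_abs_le_one _).2 (h.bounded i j)
        rwa [pow_two] at this
    _ = n := by simp

/-- For u = Q⁻¹ c_j, coercivity and Cauchy-Schwarz give (γ/n)|u|² ≤ c_j ⬝ u ≤ √n |u|. Hence |u| ≤
n^(3/2)/γ, and |c_i ⬝ u| ≤ √n |u|. -/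
theorem abs_gainKernel_le (h : Explores c b γ p) (i j : ι) :
    |gainKernel c p i j| ≤ n ^ 2 / γ := by
  have hn : (0 : ℝ) < n := Nat.cast_pos.2 h.dim_pos
  have hγ := h.rate_pos
  set u := (secondMoment c p)⁻¹ *ᵥ c j with hu
  have h1 : secondMoment c p *ᵥ u = c j := by
    rw [hu, mulVec_mulVec, mul_nonsing_inv _ h.isUnit_det, one_mulVec]
  have h2 := h.le_dotProduct_secondMoment u
  rw [h1, dotProduct_comm u (c j)] at h2
  have h3 := h.abs_dotProduct_le j u
  have h4 := h.abs_dotProduct_le i u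
  have hu0 : 0 ≤ u ⬝ᵥ u := Finset.sum_nonneg fun _ _ => mul_self_nonneg _
  have h5 : (γ / n * (u ⬝ᵥ u)) ^ 2 ≤ n * (u ⬝ᵥ u) :=
    (pow_le_pow_left₀ (by positivity) h2 2).trans h3
  have h6 : u ⬝ᵥ u ≤ n ^ 3 / γ ^ 2 := by
    rcases hu0.eq_or_lt with h0 | hpos
    · rw [← h0]; positivity
    · rw [le_div_iff₀ (by positivity)]
      have h7 : (u ⬝ᵥ u) * ((u ⬝ᵥ u) * γ ^ 2) ≤ (u ⬝ᵥ u) * n ^ 3 := by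
        have := mul_le_mul_of_nonneg_right h5 (sq_nonneg (n : ℝ))
        calc _ = (γ / n * (u ⬝ᵥ u)) ^ 2 * n ^ 2 := by field_simp
          _ ≤ _ := this
          _ = _ := by ring
      exact le_of_mul_le_mul_left h7 hpos
  refine abs_le_of_sq_le_sq ?_ (by positivity)
  calc gainKernel c p i j ^ 2 ≤ n * (u ⬝ᵥ u) := h4
    _ ≤ n * (n ^ 3 / γ ^ 2) := by gcongr
    _ = (n ^ 2 / γ) ^ 2 := by ring

end Explores

/-! ### Exponential weights and their potential. -/

/-- The exponential weights of the cumulative gains `S` at learning rate `η`. -/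
noncomputable def expWeights (η : ℝ) (S : ι → ℝ) (i : ι) : ℝ :=
  Real.exp (η * S i) / ∑ j, Real.exp (η * S j)

/-- The exponential weights potential relative to the point `i₀`. -/
noncomputable def potential (η : ℝ) (i₀ : ι) (S : ι → ℝ) : ℝ :=
  Real.log (∑ j, Real.exp (η * S j)) / η - S i₀

section ExpWeights

variable [Nonempty ι]

theorem sum_exp_pos (η : ℝ) (S : ι → ℝ) : 0 < ∑ j, Real.exp (η * S j) :=
  Finset.sum_pos (fun _ _ => Real.exp_pos _) Finset.univ_nonempty

theorem expWeights_nonneg (η : ℝ) (S : ι → ℝ) (i : ι) : 0 ≤ expWeights η S i :=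
  div_nonneg (Real.exp_pos _).le (sum_exp_pos η S).le

theorem sum_expWeights (η : ℝ) (S : ι → ℝ) : ∑ i, expWeights η S i = 1 := by
  simp only [expWeights]
  rw [← Finset.sum_div, div_self (sum_exp_pos η S).ne']

theorem potential_nonneg {η : ℝ} (hη : 0 < η) (i₀ : ι) (S : ι → ℝ) : 0 ≤ potential η i₀ S := by
  rw [potential, sub_nonneg, le_div_iff₀ hη, Real.le_log_iff_exp_le (sum_exp_pos η S), mul_comm]
  exact Finset.single_le_sum (f := fun j => Real.exp (η * S j)) (fun _ _ => (Real.exp_pos _).le)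
    (Finset.mem_univ i₀)

/-- The second-order Hedge inequality, from exp x ≤ 1 + x + x² for |x| ≤ 1 and log x ≤ x - 1. -/
theorem potential_add_le {η : ℝ} (hη : 0 < η) (i₀ : ι) (S y : ι → ℝ) (hy : ∀ i, |η * y i| ≤ 1) :
    potential η i₀ (S + y) ≤ potential η i₀ S + ∑ i, expWeights η S i * y i +
      η * ∑ i, expWeights η S i * y i ^ 2 - y i₀ := by
  have hS := sum_exp_pos η S
  set q := expWeights η S
  have h1 : ∑ j, Real.exp (η * (S + y) j) =
      (∑ j, Real.exp (η * S j)) * ∑ j, q j * Real.exp (η * y j) := by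
    rw [Finset.mul_sum]
    refine Finset.sum_congr rfl fun j _ => ?_
    simp only [q, expWeights, Pi.add_apply, mul_add, Real.exp_add]
    field_simp
  have h2 : ∑ j, q j * Real.exp (η * y j) ≤
      1 + η * (∑ i, q i * y i + η * ∑ i, q i * y i ^ 2) := by
    calc ∑ j, q j * Real.exp (η * y j) ≤ ∑ j, q j * (1 + η * y j + (η * y j) ^ 2) := by
          refine Finset.sum_le_sum fun j _ =>
            mul_le_mul_of_nonneg_left ?_ (expWeights_nonneg η S j)
          have := (abs_le.1 (Real.abs_exp_sub_one_sub_id_le (hy j))).2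
          linarith
      _ = _ := by
          conv_rhs => rw [← sum_expWeights η S]
          simp only [Finset.mul_sum, mul_add, ← Finset.sum_add_distrib, ← add_assoc]
          refine Finset.sum_congr rfl fun j _ => ?_
          ring
  have hpos : 0 < ∑ j, q j * Real.exp (η * y j) := by
    have := sum_exp_pos η (S + y)
    rw [h1] at this
    exact pos_of_mul_pos_right this hS.le
  have h3 : Real.log (∑ j, q j * Real.exp (η * y j)) ≤
      η * (∑ i, q i * y i + η * ∑ i, q i * y i ^ 2) := by
    have := Real.log_le_sub_one_of_pos hpos
    linarith
  have h4 : Real.log (∑ j, q j * Real.exp (η * y j)) / η ≤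
      ∑ i, q i * y i + η * ∑ i, q i * y i ^ 2 := by
    rwa [div_le_iff₀' hη]
  rw [potential, potential, h1, Real.log_mul hS.ne' hpos.ne', add_div, Pi.add_apply]
  linarith

/-- A bound on the potential that is used only for integrability. -/
theorem potential_le {η B : ℝ} (hη : 0 < η) (i₀ : ι) (S : ι → ℝ) (hS : ∀ i, |S i| ≤ B) :
    potential η i₀ S ≤ Real.log (Fintype.card ι) / η + 2 * B := by
  have h1 : ∑ j, Real.exp (η * S j) ≤ Fintype.card ι * Real.exp (η * B) := by
    rw [← nsmul_eq_mul, ← Finset.card_univ]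
    refine Finset.sum_le_card_nsmul _ _ _ fun j _ => Real.exp_le_exp.2 ?_
    exact mul_le_mul_of_nonneg_left (abs_le.1 (hS j)).2 hη.le
  have h2 := Real.log_le_log (sum_exp_pos η S) h1
  rw [Real.log_mul (Nat.cast_ne_zero.2 Fintype.card_ne_zero) (Real.exp_pos _).ne',
    Real.log_exp] at h2
  have h3 : Real.log (∑ j, Real.exp (η * S j)) / η ≤ Real.log (Fintype.card ι) / η + B := by
    rw [div_le_iff₀ hη, add_mul, div_mul_cancel₀ _ hη.ne']
    linarith
  have := (abs_le.1 (hS i₀)).1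
  rw [potential]
  linarith

omit [Nonempty ι] in
theorem potential_zero (η : ℝ) (i₀ : ι) :
    potential η i₀ 0 = Real.log (Fintype.card ι) / η := by
  simp [potential]

end ExpWeights

/-! ### One round of the mixed strategy. -/

/-- Exponential weights mixed with uniform exploration of the spanner `b` at rate `γ`. -/
noncomputable def mixedWeights (b : Fin n → ι) (η γ : ℝ) (S : ι → ℝ) (i : ι) : ℝ :=
  open Classical in (1 - γ) * expWeights η S i + γ / n * ∑ j, if b j = i then 1 else 0

/-- The estimated gains after the reward `x` of the point `j` has been observed. -/
noncomputable def estimatedGain (c : ι → Fin n → ℝ) (b : Fin n → ι) (η γ : ℝ) (S : ι → ℝ) (j : ι)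
    (x : ℝ) (i : ι) : ℝ :=
  -- Clipping changes nothing for rewards in [0, 1], but bounds the estimates on every history
  -- rather than almost every one.
  gainKernel c (mixedWeights b η γ S) i j * max 0 (min x 1)

section MixedWeights

variable [Nonempty ι] {c : ι → Fin n → ℝ} {b : Fin n → ι} {η γ : ℝ}

omit [Nonempty ι] in
theorem le_mixedWeights (hγ : 0 ≤ γ) (S : ι → ℝ) (i : ι) :
    (1 - γ) * expWeights η S i ≤ mixedWeights b η γ S i :=
  le_add_of_nonneg_right (mul_nonneg (div_nonneg hγ (Nat.cast_nonneg n))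
    (Finset.sum_nonneg fun j _ => by split_ifs <;> norm_num))

theorem mixedWeights_nonneg (hγ : 0 ≤ γ) (hγ1 : γ ≤ 1) (S : ι → ℝ) (i : ι) :
    0 ≤ mixedWeights b η γ S i :=
  (mul_nonneg (sub_nonneg.2 hγ1) (expWeights_nonneg η S i)).trans (le_mixedWeights hγ S i)

theorem sum_mixedWeights (hn : 0 < n) (S : ι → ℝ) : ∑ i, mixedWeights b η γ S i = 1 := by
  classical
  have hn' : (n : ℝ) ≠ 0 := Nat.cast_ne_zero.2 hn.ne'
  simp only [mixedWeights]
  rw [Finset.sum_add_distrib, ← Finset.mul_sum, sum_expWeights, ← Finset.mul_sum,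
    Finset.sum_comm]
  simp only [Finset.sum_ite_eq, Finset.mem_univ, if_true, Finset.sum_const, Finset.card_univ,
    Fintype.card_fin, nsmul_eq_mul, mul_one]
  field_simp
  ring

theorem explores_mixedWeights (hn : 0 < n) (hγ : 0 < γ) (hγ1 : γ ≤ 1)
    (hb : ∀ j, c (b j) = Pi.single j 1) (hc : ∀ i j, |c i j| ≤ 1) (S : ι → ℝ) :
    Explores c b γ (mixedWeights b η γ S) where
  rate_pos := hγ
  dim_pos := hn
  basis := hb
  bounded := hc
  nonneg := mixedWeights_nonneg hγ.le hγ1 S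
  share j := by
    classical
    have h1 : (1 : ℝ) ≤ ∑ j', if b j' = b j then 1 else 0 := by
      have := Finset.single_le_sum (f := fun j' => if b j' = b j then (1 : ℝ) else 0)
        (fun _ _ => by split_ifs <;> norm_num) (Finset.mem_univ j)
      simpa using this
    have h2 := mul_le_mul_of_nonneg_left h1 (div_nonneg hγ.le (Nat.cast_nonneg n))
    have h3 := mul_nonneg (sub_nonneg.2 hγ1) (expWeights_nonneg η S (b j))
    rw [mixedWeights]
    linarith

theorem abs_estimatedGain_le (hn : 0 < n) (hγ : 0 < γ) (hγ1 : γ ≤ 1)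
    (hb : ∀ j, c (b j) = Pi.single j 1) (hc : ∀ i j, |c i j| ≤ 1) (S : ι → ℝ) (j : ι) (x : ℝ)
    (i : ι) : |estimatedGain c b η γ S j x i| ≤ n ^ 2 / γ := by
  rw [estimatedGain, abs_mul]
  have h1 : |max 0 (min x 1)| ≤ 1 := by
    rw [abs_of_nonneg (le_max_left _ _)]
    exact max_le zero_le_one (min_le_right _ _)
  exact (mul_le_of_le_one_right (abs_nonneg _) h1).trans
    ((explores_mixedWeights hn hγ hγ1 hb hc S).abs_gainKernel_le i j)

omit [Nonempty ι] in
@[fun_prop]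
theorem measurable_expWeights (η : ℝ) (i : ι) : Measurable fun S => expWeights η S i := by
  unfold expWeights
  fun_prop

omit [Nonempty ι] in
@[fun_prop]
theorem measurable_mixedWeights (i : ι) : Measurable fun S => mixedWeights b η γ S i := by
  unfold mixedWeights
  fun_prop

omit [Nonempty ι] in
@[fun_prop]
theorem measurable_potential (i₀ : ι) : Measurable (potential η i₀) := by
  unfold potential
  fun_prop

omit [Nonempty ι] in
theorem measurable_gainKernel (c : ι → Fin n → ℝ) (i j : ι) :
    Measurable fun p => gainKernel c p i j := by
  have hQ : Continuous fun p : ι → ℝ => secondMoment c p := by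
    unfold secondMoment
    fun_prop
  have hinv : ∀ s t, Measurable fun p => (secondMoment c p)⁻¹ s t := by
    intro s t
    simp only [Matrix.inv_def, Ring.inverse_eq_inv', Matrix.smul_apply, smul_eq_mul]
    exact hQ.matrix_det.measurable.inv.mul (hQ.matrix_adjugate.matrix_elem s t).measurable
  unfold gainKernel dotProduct mulVec
  exact Finset.measurable_sum _ fun s _ => measurable_const.mul
    (Finset.measurable_sum _ fun t _ => (hinv s t).mul measurable_const)

omit [Nonempty ι] in
theorem measurable_estimatedGain (c : ι → Fin n → ℝ) (b : Fin n → ι) (η γ : ℝ) (j : ι) :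
    Measurable fun z : (ι → ℝ) × ℝ => estimatedGain c b η γ z.1 j z.2 := by
  refine measurable_pi_iff.2 fun i => ?_
  have h1 : Measurable fun z : (ι → ℝ) × ℝ => mixedWeights b η γ z.1 :=
    measurable_pi_iff.2 fun i => (measurable_mixedWeights i).comp measurable_fst
  exact ((measurable_gainKernel c i j).comp h1).mul
    (measurable_const.max (measurable_snd.min measurable_const))

omit [Nonempty ι] in
theorem measurable_estimatedGain_right (c : ι → Fin n → ℝ) (b : Fin n → ι) (η γ : ℝ) (S : ι → ℝ)
    (j : ι) : Measurable fun x : ℝ => estimatedGain c b η γ S j x := by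
  have h : Measurable fun x : ℝ => (S, x) := measurable_prodMk_left
  have := (measurable_estimatedGain c b η γ j).comp h
  exact this

/-- The hypothesis `η * n ^ 2 ≤ γ` keeps η times every estimated gain in [-1, 1], as the Hedge
inequality requires. -/
theorem potential_add_estimatedGain_le (hη : 0 < η) (hn : 0 < n) (hγ : 0 < γ) (hγ1 : γ ≤ 1)
    (hηγ : η * n ^ 2 ≤ γ) (hb : ∀ j, c (b j) = Pi.single j 1) (hc : ∀ i j, |c i j| ≤ 1)
    (i₀ : ι) (S : ι → ℝ) (j : ι) {x : ℝ} (hx : x ∈ Set.Icc (0 : ℝ) 1) :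
    potential η i₀ (S + estimatedGain c b η γ S j x) ≤
      (potential η i₀ S +
          η * ∑ i, expWeights η S i * gainKernel c (mixedWeights b η γ S) i j ^ 2) +
        (∑ i, expWeights η S i * gainKernel c (mixedWeights b η γ S) i j -
          gainKernel c (mixedWeights b η γ S) i₀ j) * x := by
  set q := expWeights η S
  set G := gainKernel c (mixedWeights b η γ S)
  have hq0 : ∀ i, 0 ≤ q i := expWeights_nonneg η S
  have hy : ∀ i, estimatedGain c b η γ S j x i = G i j * x := fun i => by
    rw [estimatedGain, min_eq_left hx.2, max_eq_right hx.1]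
  have hb1 : ∀ i, |η * estimatedGain c b η γ S j x i| ≤ 1 := fun i => by
    rw [abs_mul, abs_of_pos hη]
    have := abs_estimatedGain_le (η := η) hn hγ hγ1 hb hc S j x i
    calc η * |estimatedGain c b η γ S j x i| ≤ η * (n ^ 2 / γ) := by gcongr
      _ = η * n ^ 2 / γ := by ring
      _ ≤ 1 := (div_le_one hγ).2 hηγ
  have h1 := potential_add_le hη i₀ S _ hb1
  simp only [hy] at h1
  have h2 : ∑ i, q i * (G i j * x) ^ 2 ≤ ∑ i, q i * G i j ^ 2 := by
    refine Finset.sum_le_sum fun i _ => mul_le_mul_of_nonneg_left ?_ (hq0 i)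
    rw [mul_pow]
    exact mul_le_of_le_one_right (sq_nonneg _) (pow_le_one₀ hx.1 hx.2)
  have h3 := mul_le_mul_of_nonneg_left h2 hη.le
  have h4 : ∑ i, q i * (G i j * x) = (∑ i, q i * G i j) * x := by
    rw [Finset.sum_mul]; exact Finset.sum_congr rfl fun i _ => by ring
  rw [h4] at h1
  rw [sub_mul]
  linarith

theorem integral_regret_add_potential_le (hη : 0 < η) (hn : 0 < n) (hγ : 0 < γ) (hγ1 : γ ≤ 1)
    (hηγ : η * n ^ 2 ≤ γ) (hb : ∀ j, c (b j) = Pi.single j 1) (hc : ∀ i j, |c i j| ≤ 1)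
    (i₀ : ι) (S : ι → ℝ) (j : ι) (ν : Measure ℝ) [IsProbabilityMeasure ν]
    (hν : ∀ᵐ x ∂ν, x ∈ Set.Icc (0 : ℝ) 1) (r : ℝ) :
    ∫ x, (r + potential η i₀ (S + estimatedGain c b η γ S j x)) ∂ν ≤
      (r + potential η i₀ S +
          η * ∑ i, expWeights η S i * gainKernel c (mixedWeights b η γ S) i j ^ 2) +
        (∑ i, expWeights η S i * gainKernel c (mixedWeights b η γ S) i j -
          gainKernel c (mixedWeights b η γ S) i₀ j) * ∫ x, x ∂ν := by
  set K := η * ∑ i, expWeights η S i * gainKernel c (mixedWeights b η γ S) i j ^ 2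
  set L := ∑ i, expWeights η S i * gainKernel c (mixedWeights b η γ S) i j -
    gainKernel c (mixedWeights b η γ S) i₀ j
  have hint : Integrable (fun x : ℝ => x) ν :=
    Integrable.of_bound measurable_id.aestronglyMeasurable 1 (hν.mono fun x hx => by
      rw [Real.norm_eq_abs, abs_of_nonneg hx.1]; exact hx.2)
  have hle : ∀ᵐ x ∂ν, r + potential η i₀ (S + estimatedGain c b η γ S j x) ≤
      (r + potential η i₀ S + K) + L * x := by
    filter_upwards [hν] with x hx
    have := potential_add_estimatedGain_le hη hn hγ hγ1 hηγ hb hc i₀ S j hx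
    linarith
  have hmeas : Measurable fun x => r + potential η i₀ (S + estimatedGain c b η γ S j x) := by
    have h1 : Measurable fun x : ℝ => S + estimatedGain c b η γ S j x :=
      measurable_const.add (measurable_estimatedGain_right c b η γ S j)
    exact ((measurable_potential (η := η) i₀).comp h1).const_add r
  have hlow : ∀ x, r ≤ r + potential η i₀ (S + estimatedGain c b η γ S j x) := fun x =>
    le_add_of_nonneg_right (potential_nonneg hη i₀ _)
  have hRint : Integrable (fun x => (r + potential η i₀ S + K) + L * x) ν :=
    (integrable_const _).add (hint.const_mul _)
  have hLint := integrable_of_le_of_le hmeas.aestronglyMeasurable (ae_of_all _ hlow) hle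
    (integrable_const _) hRint
  refine (integral_mono_ae hLint hRint hle).trans_eq ?_
  rw [integral_add (integrable_const _) (hint.const_mul _), integral_const_mul]
  simp

/-- The one-step inequality of the analysis: the expected regret of a round plus the expected
potential after the round is at most the potential before the round plus `2 η n + γ`. -/
theorem sum_mixedWeights_mul_integral_le (hη : 0 < η) (hn : 0 < n) (hγ : 0 < γ) (hγ1 : γ ≤ 1 / 2)
    (hηγ : η * n ^ 2 ≤ γ) (hb : ∀ j, c (b j) = Pi.single j 1) (hc : ∀ i j, |c i j| ≤ 1)
    (ν : ι → Measure ℝ) [∀ i, IsProbabilityMeasure (ν i)]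
    (hν : ∀ i, ∀ᵐ x ∂ν i, x ∈ Set.Icc (0 : ℝ) 1) (V : ι → ℝ) (hV : ∀ i, V i = ∫ x, x ∂ν i)
    (θ : Fin n → ℝ) (hθ : ∀ i, V i = c i ⬝ᵥ θ) (i₀ : ι) (S : ι → ℝ) (r : ℝ) :
    ∑ j, mixedWeights b η γ S j *
        ∫ x, (r + (V i₀ - V j) + potential η i₀ (S + estimatedGain c b η γ S j x)) ∂ν j ≤
      r + potential η i₀ S + (2 * η * n + γ) := by
  have hγ1' : γ ≤ 1 := by linarith
  set p := mixedWeights b η γ S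
  set q := expWeights η S
  have hE : Explores c b γ p := explores_mixedWeights hn hγ hγ1' hb hc S
  set G := gainKernel c p
  have hq0 : ∀ i, 0 ≤ q i := expWeights_nonneg η S
  have hint : ∀ j, Integrable (fun x : ℝ => x) (ν j) := fun j =>
    Integrable.of_bound (by fun_prop) 1 ((hν j).mono fun x hx => by
      rw [Real.norm_eq_abs, abs_of_nonneg hx.1]; exact hx.2)
  have hV0 : ∀ i, 0 ≤ V i := fun i => by
    rw [hV]; exact integral_nonneg_of_ae ((hν i).mono fun x hx => hx.1)
  have hV1 : ∀ i, V i ≤ 1 := fun i => by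
    rw [hV]
    simpa using integral_mono_ae (hint i) (integrable_const 1) ((hν i).mono fun x hx => hx.2)
  have hstep : ∀ j, ∫ x, (r + (V i₀ - V j) + potential η i₀ (S + estimatedGain c b η γ S j x)) ∂ν j ≤
      (r + (V i₀ - V j) + potential η i₀ S + η * ∑ i, q i * G i j ^ 2) +
        (∑ i, q i * G i j - G i₀ j) * V j := fun j =>
    (integral_regret_add_potential_le hη hn hγ hγ1' hηγ hb hc i₀ S j (ν j) (hν j) _).trans_eq
      (by rw [← hV])
  have hunb : ∀ i, ∑ j, p j * (G i j * V j) = V i := fun i => by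
    simp only [hθ]
    exact hE.sum_gainKernel_mul θ i
  -- Since γ ≤ 1/2, q ≤ 2p; this trades the exponential weights for the sampling law, under which
  -- the variance averages to n.
  have hsq : ∑ j, p j * ∑ i, q i * G i j ^ 2 ≤ 2 * n := by
    calc ∑ j, p j * ∑ i, q i * G i j ^ 2 = ∑ i, q i * ∑ j, p j * G i j ^ 2 := by
          simp only [Finset.mul_sum]
          rw [Finset.sum_comm]
          exact Finset.sum_congr rfl fun i _ => Finset.sum_congr rfl fun j _ => by ring
      _ ≤ ∑ i, 2 * p i * ∑ j, p j * G i j ^ 2 := by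
          refine Finset.sum_le_sum fun i _ => mul_le_mul_of_nonneg_right ?_
            (Finset.sum_nonneg fun j _ => mul_nonneg (hE.nonneg j) (sq_nonneg _))
          have h1 : (1 - γ) * q i ≤ p i := le_mixedWeights hγ.le S i
          nlinarith [hq0 i]
      _ = 2 * ∑ i, p i * G i i := by
          rw [Finset.mul_sum]
          exact Finset.sum_congr rfl fun i _ => by rw [hE.sum_gainKernel_sq, mul_assoc]
      _ = 2 * n := by rw [hE.sum_gainKernel_self]
  have hqV : ∑ j, p j * ((∑ i, q i * G i j - G i₀ j) * V j) = ∑ i, q i * V i - V i₀ := by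
    calc _ = ∑ i, q i * ∑ j, p j * (G i j * V j) - ∑ j, p j * (G i₀ j * V j) := by
          simp only [Finset.mul_sum]
          rw [Finset.sum_comm, ← Finset.sum_sub_distrib]
          refine Finset.sum_congr rfl fun j _ => ?_
          rw [sub_mul, mul_sub, Finset.sum_mul, Finset.mul_sum]
          congr 1
          exact Finset.sum_congr rfl fun i _ => by ring
      _ = _ := by simp only [hunb]
  -- The price of exploration is at most γ, because values lie in [0, 1].
  have hpV : ∑ i, q i * V i - γ ≤ ∑ j, p j * V j := by
    have h1 : ∑ i, (1 - γ) * q i * V i ≤ ∑ j, p j * V j := Finset.sum_le_sum fun i _ =>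
      mul_le_mul_of_nonneg_right (le_mixedWeights hγ.le S i) (hV0 i)
    have h2 : ∑ i, q i * V i ≤ 1 := by
      rw [← sum_expWeights η S]
      exact Finset.sum_le_sum fun i _ => mul_le_of_le_one_right (hq0 i) (hV1 i)
    have h3 : ∑ i, (1 - γ) * q i * V i = (1 - γ) * ∑ i, q i * V i := by
      rw [Finset.mul_sum]; exact Finset.sum_congr rfl fun i _ => by ring
    nlinarith
  have hp1 : ∑ j, p j = 1 := sum_mixedWeights hn S
  calc _ ≤ ∑ j, p j * ((r + (V i₀ - V j) + potential η i₀ S + η * ∑ i, q i * G i j ^ 2) +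
        (∑ i, q i * G i j - G i₀ j) * V j) :=
        Finset.sum_le_sum fun j _ => mul_le_mul_of_nonneg_left (hstep j) (hE.nonneg j)
    _ = (r + V i₀ + potential η i₀ S) * ∑ j, p j - ∑ j, p j * V j +
        η * ∑ j, p j * ∑ i, q i * G i j ^ 2 +
          ∑ j, p j * ((∑ i, q i * G i j - G i₀ j) * V j) := by
        rw [Finset.mul_sum, Finset.mul_sum (s := Finset.univ) (a := η), ← Finset.sum_sub_distrib,
          ← Finset.sum_add_distrib, ← Finset.sum_add_distrib]
        exact Finset.sum_congr rfl fun j _ => by ring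
    _ ≤ _ := by
        rw [hp1, hqV]
        have := mul_le_mul_of_nonneg_left hsq hη.le
        linarith

end MixedWeights

end LinearBandit

/-! ### The algorithm on histories and its regret. -/

namespace BanditAlgorithm

variable {H k A : ℕ}

/-- The kernel to a finite type with the weights `p`. -/
noncomputable def weightsKernel {X ι : Type*} [MeasurableSpace X] [Fintype ι] [MeasurableSpace ι]
    (p : X → ι → ℝ) (hp : ∀ i, Measurable fun x => p x i) : Kernel X ι where
  toFun x := ∑ i, ENNReal.ofReal (p x i) • Measure.dirac i
  measurable' := Measure.measurable_of_measurable_coe _ fun s _ => by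
    simp only [Measure.finsetSum_apply, Measure.smul_apply, smul_eq_mul]
    exact Finset.measurable_sum _ fun i _ => (hp i).ennreal_ofReal.mul_const _

theorem isMarkovKernel_weightsKernel {X ι : Type*} [MeasurableSpace X] [Fintype ι]
    [MeasurableSpace ι] {p : X → ι → ℝ} (hp : ∀ i, Measurable fun x => p x i)
    (h0 : ∀ x i, 0 ≤ p x i) (h1 : ∀ x, ∑ i, p x i = 1) :
    IsMarkovKernel (weightsKernel p hp) := by
  refine ⟨fun x => ⟨?_⟩⟩
  change (∑ i, ENNReal.ofReal (p x i) • Measure.dirac i : Measure ι) Set.univ = 1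
  simp only [Measure.finsetSum_apply, Measure.smul_apply, smul_eq_mul, measure_univ, mul_one]
  rw [← ENNReal.ofReal_sum_of_nonneg fun i _ => h0 x i, h1, ENNReal.ofReal_one]

theorem integral_weightsKernel {X ι : Type*} [MeasurableSpace X] [Fintype ι]
    [MeasurableSpace ι] [MeasurableSingletonClass ι] {p : X → ι → ℝ}
    (hp : ∀ i, Measurable fun x => p x i)
    (h0 : ∀ x i, 0 ≤ p x i) (f : ι → ℝ) (x : X) :
    ∫ i, f i ∂weightsKernel p hp x = ∑ i, p x i * f i := by
  change ∫ i, f i ∂(∑ i, ENNReal.ofReal (p x i) • Measure.dirac i : Measure ι) = _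
  rw [integral_finsetSum_measure fun i _ =>
    (integrable_dirac (by simp)).smul_measure ENNReal.ofReal_ne_top]
  refine Finset.sum_congr rfl fun i _ => ?_
  rw [integral_smul_measure, integral_dirac, ENNReal.toReal_ofReal (h0 x i), smul_eq_mul]

open LinearBandit

variable {n : ℕ} (c : Policy H k A → Fin n → ℝ) (b : Fin n → Policy H k A) (η γ : ℝ)

/-- The sum of the estimated gains of the episodes of a history. -/
noncomputable def cumulativeGain : (t : ℕ) → History H k A t → Policy H k A → ℝ
  | 0, _ => 0
  | t + 1, h =>
    cumulativeGain t (Fin.init h) +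
      estimatedGain c b η γ (cumulativeGain t (Fin.init h)) (h (Fin.last t)).1 (h (Fin.last t)).2

theorem measurable_cumulativeGain (t : ℕ) : Measurable (cumulativeGain c b η γ t) := by
  induction t with
  | zero => exact measurable_const
  | succ t ih =>
    have hinit : Measurable fun h : History H k A (t + 1) => (Fin.init h : History H k A t) :=
      measurable_pi_iff.2 fun j => measurable_pi_apply j.castSucc
    have hS : Measurable fun h : History H k A (t + 1) => cumulativeGain c b η γ t (Fin.init h) :=
      ih.comp hinit
    have hlast : Measurable fun h : History H k A (t + 1) => h (Fin.last t) :=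
      measurable_pi_apply _
    have hgain : Measurable fun z : Policy H k A × ((Policy H k A → ℝ) × ℝ) =>
        estimatedGain c b η γ z.2.1 z.1 z.2.2 :=
      measurable_from_prod_countable_right fun π => measurable_estimatedGain c b η γ π
    have hcomp : Measurable fun h : History H k A (t + 1) =>
        ((h (Fin.last t)).1, (cumulativeGain c b η γ t (Fin.init h), (h (Fin.last t)).2)) :=
      (measurable_fst.comp hlast).prodMk (hS.prodMk (measurable_snd.comp hlast))
    have := hgain.comp hcomp
    exact hS.add this

theorem abs_cumulativeGain_le [NeZero A] {c : Policy H k A → Fin n → ℝ}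
    {b : Fin n → Policy H k A} {η γ : ℝ} (hn : 0 < n) (hγ : 0 < γ) (hγ1 : γ ≤ 1)
    (hb : ∀ j, c (b j) = Pi.single j 1) (hc : ∀ i j, |c i j| ≤ 1) (t : ℕ) (h : History H k A t)
    (π : Policy H k A) : |cumulativeGain c b η γ t h π| ≤ t * (n ^ 2 / γ) := by
  induction t with
  | zero => simp [cumulativeGain]
  | succ t ih =>
    rw [cumulativeGain, Pi.add_apply]
    refine (abs_add_le _ _).trans ((add_le_add (ih _)
      (abs_estimatedGain_le hn hγ hγ1 hb hc _ _ _ _)).trans_eq ?_)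
    push_cast
    ring

theorem measurable_mixedWeights_cumulativeGain (t : ℕ) (π : Policy H k A) :
    Measurable fun h : History H k A t =>
      mixedWeights b η γ (cumulativeGain c b η γ t h) π :=
  (measurable_mixedWeights π).comp (measurable_cumulativeGain c b η γ t)

/-- Exponential weights with estimated gains, mixed with exploration of the spanner `b`. -/
noncomputable def exponentialWeights [NeZero A] (hn : 0 < n) (hγ : 0 ≤ γ) (hγ1 : γ ≤ 1) :
    BanditAlgorithm H k A where
  choose _ := weightsKernel (fun h => mixedWeights b η γ (cumulativeGain c b η γ _ h))
    (measurable_mixedWeights_cumulativeGain c b η γ _)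
  isMarkovKernel_choose _ := isMarkovKernel_weightsKernel _
    (fun _ => mixedWeights_nonneg hγ hγ1 _) (fun _ => sum_mixedWeights hn _)

variable [NeZero k]

/-- Conditioning on the first `t` episodes; boundedness of `F` supplies the integrability for
Fubini. -/
theorem integral_historyLaw_succ (alg : BanditAlgorithm H k A) (M : EpisodicMDP H k A) (t : ℕ)
    {F : History H k A (t + 1) → ℝ} (hF : Measurable F) {K : ℝ} (hK : ∀ h, |F h| ≤ K) :
    ∫ h, F h ∂alg.historyLaw M (t + 1) =
      ∫ h, ∫ π, ∫ x, F (Fin.snoc (α := fun _ => Policy H k A × ℝ) h (π, x))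
        ∂M.episodeReward π ∂alg.choose t h ∂alg.historyLaw M t := by
  have := alg.isMarkovKernel_choose t
  have hsnoc := measurable_snoc_history (H := H) (k := k) (A := A) t
  have hFs := hF.comp hsnoc
  rw [historyLaw, integral_map hsnoc.aemeasurable hF.aestronglyMeasurable]
  have hint : Integrable (fun z : (History H k A t × Policy H k A) × ℝ =>
      F (Fin.snoc (α := fun _ => Policy H k A × ℝ) z.1.1 (z.1.2, z.2)))
      ((alg.historyLaw M t ⊗ₘ alg.choose t) ⊗ₘ
        M.episodeReward.prodMkLeft (History H k A t)) :=
    Integrable.of_bound hFs.aestronglyMeasurable K (ae_of_all _ fun z => hK _)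
  have hint' : Integrable (fun z : History H k A t × Policy H k A =>
      ∫ x, F (Fin.snoc (α := fun _ => Policy H k A × ℝ) z.1 (z.2, x)) ∂M.episodeReward z.2)
      (alg.historyLaw M t ⊗ₘ alg.choose t) := by
    refine Integrable.of_bound ?_ K (ae_of_all _ fun z => ?_)
    · exact (hFs.stronglyMeasurable.integral_kernel_prod_right'
        (κ := M.episodeReward.prodMkLeft (History H k A t))).aestronglyMeasurable
    · have := norm_integral_le_of_norm_le_const (μ := M.episodeReward z.2) (ae_of_all _ fun x =>
        (Real.norm_eq_abs _).trans_le (hK (Fin.snoc (α := fun _ => Policy H k A × ℝ) z.1 (z.2, x))))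
      rwa [probReal_univ, mul_one] at this
  exact (Measure.integral_compProd hint).trans (Measure.integral_compProd hint')

theorem exists_value_eq_opt [NeZero A] (M : EpisodicMDP H k A) :
    ∃ π₀, M.value π₀ = M.opt ∧ ∀ π, M.value π ≤ M.value π₀ := by
  obtain ⟨π₀, h⟩ := exists_eq_ciSup_of_finite (f := M.value)
  exact ⟨π₀, h, fun π => h.symm ▸ le_ciSup (Set.finite_range _).bddAbove π⟩

theorem expectedRegret_exponentialWeights_le [NeZero A] {c : Policy H k A → Fin n → ℝ}
    {b : Fin n → Policy H k A} {η γ : ℝ} (hη : 0 < η) (hn : 0 < n) (hγ : 0 < γ)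
    (hγ1 : γ ≤ 1 / 2) (hηγ : η * n ^ 2 ≤ γ) (hb : ∀ j, c (b j) = Pi.single j 1)
    (hc : ∀ i j, |c i j| ≤ 1) {M : EpisodicMDP H k A} (hM : M.BoundedRewards)
    (hV : ∀ π, M.value π = ∑ j, c π j * M.value (b j)) (T : ℕ) :
    (exponentialWeights c b η γ hn hγ.le (hγ1.trans (by norm_num))).expectedRegret M T ≤
      Real.log (Fintype.card (Policy H k A)) / η + T * (2 * η * n + γ) := by
  obtain ⟨π₀, hopt, hπ₀⟩ := exists_value_eq_opt M
  have hγ1' : γ ≤ 1 := hγ1.trans (by norm_num)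
  set alg := exponentialWeights c b η γ hn hγ.le hγ1'
  -- Past regret plus potential. It starts at log (number of policies) / η, its expectation gains at
  -- most 2ηn + γ per episode, and it dominates the regret since the potential is nonnegative.
  let F : (t : ℕ) → History H k A t → ℝ := fun t h =>
    ∑ s, (M.value π₀ - M.value (h s).1) + potential η π₀ (cumulativeGain c b η γ t h)
  have hterm : ∀ π, 0 ≤ M.value π₀ - M.value π := fun π => sub_nonneg.2 (hπ₀ π)
  have hterm1 : ∀ π, M.value π₀ - M.value π ≤ 1 := fun π => by
    linarith [(hM.value_mem_Icc π₀).2, (hM.value_mem_Icc π).1]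
  have hF0 : ∀ t h, 0 ≤ F t h := fun t h =>
    add_nonneg (Finset.sum_nonneg fun s _ => hterm _) (potential_nonneg hη _ _)
  have hFmeas : ∀ t, Measurable (F t) := fun t => by
    refine (Finset.measurable_sum _ fun s _ => ?_).add
      ((measurable_potential π₀).comp (measurable_cumulativeGain c b η γ t))
    have : Measurable M.value := measurable_of_countable _
    exact measurable_const.sub (this.comp (measurable_fst.comp (measurable_pi_apply s)))
  have hFbound : ∀ t, ∃ K, ∀ h, |F t h| ≤ K := fun t => by
    refine ⟨t + (Real.log (Fintype.card (Policy H k A)) / η + 2 * (t * (n ^ 2 / γ))), fun h => ?_⟩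
    rw [abs_of_nonneg (hF0 t h)]
    refine add_le_add ?_ (potential_le hη π₀ _ (abs_cumulativeGain_le hn hγ hγ1' hb hc t h))
    have := Finset.sum_le_sum (s := Finset.univ) fun (s : Fin t) _ => hterm1 (h s).1
    simpa using this
  have hFint : ∀ t, Integrable (F t) (alg.historyLaw M t) := fun t =>
    (hFbound t).elim fun K hK =>
      Integrable.of_bound (hFmeas t).aestronglyMeasurable K (ae_of_all _ hK)
  suffices hpot : ∀ t, ∫ h, F t h ∂alg.historyLaw M t ≤
      Real.log (Fintype.card (Policy H k A)) / η + t * (2 * η * n + γ) by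
    refine le_trans ?_ (hpot T)
    rw [expectedRegret, ← hopt]
    exact integral_mono_of_nonneg (ae_of_all _ fun h => Finset.sum_nonneg fun s _ => hterm _)
      (hFint T) (ae_of_all _ fun h => le_add_of_nonneg_right (potential_nonneg hη _ _))
  intro t
  induction t with
  | zero =>
    have : ∀ h, F 0 h = Real.log (Fintype.card (Policy H k A)) / η := fun h => by
      simp [F, cumulativeGain, potential_zero]
    simp [this]
  | succ t ih =>
    obtain ⟨K, hK⟩ := hFbound (t + 1)
    rw [integral_historyLaw_succ alg M t (hFmeas (t + 1)) hK]
    have hstep : ∀ h : History H k A t,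
        ∫ π, ∫ x, F (t + 1) (Fin.snoc (α := fun _ => Policy H k A × ℝ) h (π, x))
          ∂M.episodeReward π ∂alg.choose t h ≤ F t h + (2 * η * n + γ) := fun h => by
      refine (integral_weightsKernel (measurable_mixedWeights_cumulativeGain c b η γ t)
        (fun _ => mixedWeights_nonneg hγ.le hγ1' _) _ h).trans_le ?_
      have := sum_mixedWeights_mul_integral_le hη hn hγ hγ1 hηγ hb hc
        (fun π => M.episodeReward π) hM.ae_mem_Icc M.value (fun _ => rfl)
        (fun j => M.value (b j)) hV π₀ (cumulativeGain c b η γ t h)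
        (∑ s, (M.value π₀ - M.value (h s).1))
      simpa only [F, Fin.sum_univ_castSucc, cumulativeGain, Fin.init_snoc, Fin.snoc_castSucc,
        Fin.snoc_last] using this
    have hle := integral_mono_of_nonneg
      (ae_of_all (alg.historyLaw M t) fun h => integral_nonneg fun π => integral_nonneg fun x =>
        hF0 (t + 1) (Fin.snoc (α := fun _ => Policy H k A × ℝ) h (π, x)))
      ((hFint t).add (integrable_const _)) (ae_of_all _ hstep)
    refine hle.trans ?_
    rw [integral_add' (hFint t) (integrable_const _), integral_const, probReal_univ, one_smul]
    push_cast
    linarith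

/-- The trivial bound, for horizons too short to afford the exploration rate. -/
theorem expectedRegret_le (alg : BanditAlgorithm H k A) [NeZero A] {M : EpisodicMDP H k A}
    (hM : M.BoundedRewards) (T : ℕ) : alg.expectedRegret M T ≤ T := by
  obtain ⟨π₀, hopt, hπ₀⟩ := exists_value_eq_opt M
  have hbound : ∀ h : History H k A T, ‖∑ t : Fin T, (M.opt - M.value (h t).1)‖ ≤ T := fun h => by
    rw [Real.norm_eq_abs, abs_of_nonneg (Finset.sum_nonneg fun t _ =>
      sub_nonneg.2 (hopt ▸ hπ₀ _))]
    have := Finset.sum_le_sum (s := Finset.univ) fun (t : Fin T) _ =>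
      show M.opt - M.value (h t).1 ≤ 1 by
        rw [← hopt]; linarith [(hM.value_mem_Icc π₀).2, (hM.value_mem_Icc (h t).1).1]
    simpa using this
  have := norm_integral_le_of_norm_le_const (μ := alg.historyLaw M T) (ae_of_all _ hbound)
  rw [probReal_univ, mul_one] at this
  exact (le_abs_self _).trans this

end BanditAlgorithm

/-! ### Tuning the parameters. -/

theorem EpisodicMDP.log_card_policy_le (H k A : ℕ) [NeZero A] :
    Real.log (Fintype.card (Policy H k A)) ≤ H * k * A := by
  have hA : (0 : ℝ) < A := Nat.cast_pos.2 (NeZero.pos A)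
  have : (Fintype.card (Policy H k A) : ℝ) = (A : ℝ) ^ (H * k) := by
    simp [Policy, ← pow_mul, mul_comm]
  rw [this, Real.log_pow]
  push_cast
  have := Real.log_le_sub_one_of_pos hA
  gcongr
  linarith

open EpisodicMDP BanditAlgorithm

theorem mainTheorem1 :
    ∃ C : ℝ, 0 < C ∧
      ∀ (H k A T : ℕ) [NeZero H] [NeZero k] [NeZero A], 2 ≤ T →
        ∃ alg : BanditAlgorithm H k A,
          ∀ M : EpisodicMDP H k A, M.BoundedRewards →
            alg.expectedRegret M T ≤
              C * ((H : ℝ) ^ 2 * ((A : ℝ) * (k : ℝ)) ^ H *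
                Real.sqrt ((H : ℝ) * (k : ℝ) * (A : ℝ) * (T : ℝ) * Real.log (T : ℝ))) := by
  refine ⟨8, by norm_num, fun H k A T _ _ _ hT => ?_⟩
  have hspanner := exists_barycentric_spanner (trajectorySpan ℝ H k A 0)
  have hnd := finrank_trajectorySpan_le (H := H) (k := k) (A := A) 0
  generalize Module.finrank ℝ (trajectorySpan ℝ H k A 0) = n at hspanner hnd
  obtain ⟨b, c, hval, hc, hb⟩ := hspanner
  -- The span contains the constant 1, which an empty spanner could not reproduce.
  have hn : 0 < n := by
    refine Nat.pos_of_ne_zero fun h0 => ?_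
    have : IsEmpty (Fin n) := by rw [h0]; infer_instance
    have := hval _ (one_mem_trajectorySpan ℝ 0) (fun _ _ => 0)
    simp at this
  have hT0 : (0 : ℝ) < T := by positivity
  have hn0 : (0 : ℝ) < n := Nat.cast_pos.2 hn
  have hL : (0 : ℝ) < H * k * A := by
    have := NeZero.pos H; have := NeZero.pos k; have := NeZero.pos A
    positivity
  set L : ℝ := H * k * A with hLdef
  -- With η = s/n and γ = ns, the terms L/η and γT are both n·s·T, and ηn² = γ holds exactly.
  set s := Real.sqrt (L / T) with hs
  have hs0 : 0 < s := Real.sqrt_pos.2 (by positivity)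
  have hs2 : s * s * T = L := by
    rw [hs, Real.mul_self_sqrt (by positivity)]; field_simp
  have hX : s * T ≤ 2 * Real.sqrt (L * T * Real.log T) := by
    -- This is where T ≥ 2 enters: s·T = √(LT), and log T ≥ 1/4 costs the factor 2.
    have hlog : (1 / 4 : ℝ) ≤ Real.log T := by
      have h1 := Real.log_le_log (by norm_num) (show (2 : ℝ) ≤ T by exact_mod_cast hT)
      linarith [Real.log_two_gt_d9]
    have h2 : s * T / 2 ≤ Real.sqrt (L * T * Real.log T) := by
      refine Real.le_sqrt_of_sq_le ?_
      calc (s * T / 2) ^ 2 = L * T * (1 / 4) := by rw [← hs2]; ring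
        _ ≤ _ := by gcongr
    linarith
  have hfinal : 4 * n * (s * T) ≤ 8 * ((H : ℝ) ^ 2 * ((A : ℝ) * (k : ℝ)) ^ H *
      Real.sqrt (L * T * Real.log T)) := by
    have h1 : (1 : ℝ) ≤ (H : ℝ) ^ 2 := one_le_pow₀ (Nat.one_le_cast.2 (NeZero.pos H))
    have h2 : (n : ℝ) ≤ ((A : ℝ) * (k : ℝ)) ^ H := by exact_mod_cast hnd
    calc 4 * n * (s * T) ≤ 4 * n * (2 * Real.sqrt (L * T * Real.log T)) := by gcongr
      _ = 8 * (1 * n * Real.sqrt (L * T * Real.log T)) := by ring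
      _ ≤ _ := by gcongr
  by_cases hγ1 : n * s ≤ 1 / 2
  · have hγ : 0 < n * s := by positivity
    have hη : 0 < s / n := by positivity
    refine ⟨exponentialWeights c b (s / n) (n * s) hn hγ.le (hγ1.trans (by norm_num)),
      fun M hM => ?_⟩
    refine (expectedRegret_exponentialWeights_le hη hn hγ hγ1 (le_of_eq (by field_simp)) hb hc hM
      (fun π => hval _ hM.value_mem_trajectorySpan π) T).trans (le_trans ?_ hfinal)
    have h1 : Real.log (Fintype.card (Policy H k A)) / (s / n) ≤ n * (s * T) := by
      rw [div_le_iff₀ hη]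
      refine (log_card_policy_le H k A).trans_eq ?_
      rw [← hLdef, ← hs2]
      field_simp
    have h2 : (T : ℝ) * (2 * (s / n) * n + n * s) ≤ 3 * n * (s * T) := by
      have h3 : (1 : ℝ) ≤ n := Nat.one_le_cast.2 hn
      have h4 : s / n * n = s := div_mul_cancel₀ _ hn0.ne'
      have h5 : 1 * (s * T) ≤ n * (s * T) := by gcongr
      calc (T : ℝ) * (2 * (s / n) * n + n * s) = 2 * (1 * (s * T)) + n * (s * T) := by
            rw [mul_assoc 2, h4]; ring
        _ ≤ _ := by linarith
    linarith
  -- If ns > 1/2, then T ≤ 2n·s·T already, so any algorithm will do, here a constant policy.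
  · refine ⟨⟨fun _ => Kernel.const _ (Measure.dirac fun _ _ => 0), fun _ => inferInstance⟩,
      fun M hM => (expectedRegret_le _ hM T).trans (le_trans ?_ hfinal)⟩
    have := mul_le_mul_of_nonneg_right (not_le.1 hγ1).le hT0.le
    nlinarith
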